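/- A kernel is a bounded, symmetric, measurable function $u:[0,1]^2\to\mathbb R$; a graphon is a symmetric, measurable function $w:[0,1]^2\to[0,1]$. Let $|\cdot|$ denote Lebesgue measure, $\|\cdot\|_\infty$ the essential supremum norm, and $$\|f\|_\square=\sup_{S,T\subseteq[0,1]}\Big|\iint_{S\times T}f\,dx\,dy\Big|$$ the cut norm; all sets are measurable. For sets write $A\le B$ if $a\le b$ for all $a\in A$, $b\in B$. For a kernel $f$ put $$\Lambda(f)=\frac12\sup_{\substack{A\le B\le C\\|A|=|B|=|C|}}\Big[\iint_{A\times C}f-\iint_{B\times C}f\Big]+\frac12\sup_{\substack{X\le Y\le Z\\|X|=|Y|=|Z|}}\Big[\iint_{X\times Z}f-\iint_{X\times Y}f\Big],$$ with subsets of $[0,1]$. A symmetric function $f$ is Robinson if $x\le y\le z$ implies $f(x,z)\le\min\{f(x,y),f(y,z)\}$, and Robinson a.e. if it is equal a.e. to a symmetric, integrable Robinson function. For $0<\alpha<1$ the $\alpha$-Robinson approximation $R_f^\alpha$ is the symmetric function on $[0,1]^2$ with, for $x\le y$, $$R_f^\alpha(x,y)=\sup\Big\{\frac1{|S\times T|}\iint_{S\times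 T}f\ :\ S\times T\subseteq[0,x]\times[y,1],\ |S|=|T|=\alpha\Big\},\qquad \sup\emptyset=0,$$ and $R_f^0=f$ if $f$ is Robinson a.e. Let $w$ be a graphon and $u$ a kernel, and let $$\alpha=\|w\|_\infty^{-1/3}\Lambda(w)^{2/5},\qquad \alpha^*=\|u\|_\infty^{-2/5}\Lambda(u)^{2/5},$$ where $\alpha=0$ if $\|w\|_\infty=0$ and $\alpha^*=0$ if $\|u\|_\infty=0$. Then $R_w^{\alpha}$ and $R_u^{\alpha^*}$ are integrable, and $$\|w-R_w^{\alpha}\|_\square\le 44\,\Lambda(w)^{1/5}\qquad\text{and}\qquad \|u-R_u^{\alpha^*}\|_\square\le 44\,\|u\|_\infty^{4/5}\,\Lambda(u)^{1/5}.$$ -/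

import Mathlib

open MeasureTheory

noncomputable section

/-- Functions on the unit square `[0,1]²`, written in curried form. The interval `unitInterval`
and its square carry Lebesgue measure `volume`. -/
abbrev SquareFun : Type := unitInterval → unitInterval → ℝ

/-- `w` is a kernel: a bounded, symmetric, Lebesgue measurable real function on `[0,1]²`.
(`AEMeasurable` with respect to `volume` is Lebesgue measurability; Borel functions satisfy it.) -/
structure IsKernel (w : SquareFun) : Prop where
  aemeasurable : AEMeasurable (Function.uncurry w) volume
  symm : ∀ x y, w x y = w y x
  bounded : ∃ M : ℝ, ∀ x y, |w x y| ≤ M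

/-- `w` is a graphon: a symmetric, Lebesgue measurable function `[0,1]² → [0,1]`. -/
structure IsGraphon (w : SquareFun) : Prop where
  aemeasurable : AEMeasurable (Function.uncurry w) volume
  symm : ∀ x y, w x y = w y x
  mem_Icc : ∀ x y, w x y ∈ Set.Icc (0 : ℝ) 1

/-- The essential supremum norm `‖w‖_∞` on the unit square. -/
def supNorm (w : SquareFun) : ℝ :=
  (eLpNorm (Function.uncurry w) ⊤ volume).toReal

/-- The integral of `w` over the rectangle `S × T`. -/
def rectIntegral (w : SquareFun) (S T : Set unitInterval) : ℝ :=
  ∫ p in S ×ˢ T, w p.1 p.2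

/-- The cut norm: the supremum of `|∬_{S × T} w|` over measurable `S, T ⊆ [0,1]`. -/
def cutNorm (w : SquareFun) : ℝ :=
  sSup {r : ℝ | ∃ S T : Set unitInterval, MeasurableSet S ∧ MeasurableSet T ∧
    r = |rectIntegral w S T|}

/-- The cell average of `w` over `S × T`. -/
def cellAverage (w : SquareFun) (S T : Set unitInterval) : ℝ :=
  rectIntegral w S T / volume.real (S ×ˢ T)

/-- `A ≤ B` for sets: every element of `A` is at most every element of `B`. -/
def SetLE (A B : Set unitInterval) : Prop :=
  ∀ a ∈ A, ∀ b ∈ B, a ≤ b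

/-- Measurable sets `A ≤ B ≤ C` of equal measure. -/
structure IsOrderedTriple (A B C : Set unitInterval) : Prop where
  measurable_fst : MeasurableSet A
  measurable_snd : MeasurableSet B
  measurable_trd : MeasurableSet C
  le_fst_snd : SetLE A B
  le_snd_trd : SetLE B C
  volume_fst_snd : volume A = volume B
  volume_snd_trd : volume B = volume C

/-- The Robinson parameter `Λ(w)`. -/
def robinsonParam (w : SquareFun) : ℝ :=
  (1 / 2) * sSup {r : ℝ | ∃ A B C : Set unitInterval, IsOrderedTriple A B C ∧
      r = rectIntegral w A C - rectIntegral w B C} +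
  (1 / 2) * sSup {r : ℝ | ∃ X Y Z : Set unitInterval, IsOrderedTriple X Y Z ∧
      r = rectIntegral w X Z - rectIntegral w X Y}

/-- The Robinson property. -/
def IsRobinson (w : SquareFun) : Prop :=
  ∀ x y z, x ≤ y → y ≤ z → w x z ≤ min (w x y) (w y z)

/-- `w` is Robinson almost everywhere: it agrees almost everywhere with a symmetric integrable
function on `[0,1]²` that is Robinson. -/
def IsRobinsonAE (w : SquareFun) : Prop :=
  ∃ v : SquareFun, Integrable (Function.uncurry v) volume ∧ (∀ x y, v x y = v y x) ∧
    IsRobinson v ∧ Function.uncurry v =ᵐ[volume] Function.uncurry w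

/-- The upper left region `[0,a] × [b,1]` of a point `(a,b)`. -/
def upperLeft (a b : unitInterval) : Set (unitInterval × unitInterval) :=
  Set.Iic a ×ˢ Set.Ici b

open Classical in
/-- The `α`-Robinson approximation of `w`, for `0 ≤ α < 1`. For `α > 0` its value at `(x,y)` with
`x ≤ y` is the supremum of the cell averages of `w` over the measurable `S × T ⊆ UL(x,y)` with
`|S| = |T| = α`, where the supremum of the empty set is `0`; it is extended symmetrically to
`y < x`. For `α = 0` it is `w` itself, provided `w` is Robinson almost everywhere. -/
def robinsonApprox (w : SquareFun) (α : ℝ) : SquareFun := fun x y =>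
  if α = 0 ∧ IsRobinsonAE w then w x y
  else sSup {r : ℝ | ∃ S T : Set unitInterval, MeasurableSet S ∧ MeasurableSet T ∧
    S ×ˢ T ⊆ upperLeft (min x y) (max x y) ∧ volume.real S = α ∧ volume.real T = α ∧
    r = cellAverage w S T}

end

/-! Let `M` bound `f` a.e., and let `g(x,y)` be the supremum of the `α × α` cell averages of `f` in
the upper left region of `(x,y)`. It increases in `x` and decreases in `y`, and away from the
boundary strips of width `α` it equals the Robinson approximation `R` above the diagonal.

Take a cell `P × Q` with sides of measure `α` inside a block of an `n × n` grid above the diagonal.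
Its average is at most `g` at the block's lower right corner, where the cell itself competes. It is
at least `g` at the upper left corner minus `2Λ/α²`: any competitor `S × T` there satisfies `S ≤ P ≤
Q ≤ T`, and passing from `S × T` to `P × T` to `P × Q` costs one supremum of `Λ` each
(`rectIntegral_le_add_robinsonParam`). The same two corner values enclose `R`, so `f - R` integrates
over the cell to at most `α²` times the oscillation of `g` on the block plus `2Λ/α²`.

The oscillations telescope to `O(Mn)` over `n²` blocks, there are `O(n)` diagonal and boundary
blocks, and the parts of `S × T` not filled by cells have measure `O(nα)`. Taking `n ≈ α^{-1/2}`
gives `40 M√α + 2Λ/α²` (`IsCellApprox.abs_rectIntegral_sub_le`); the prescribed `α` makes both terms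
multiples of `Λ^{1/5}`.

If `α = 0` then `Λ = 0`, and it must be shown that `f` is Robinson a.e. The same estimate applies to
a supremum over cells of all dyadic sizes at once, with no `Λ` term; letting the size tend to zero
yields equality a.e. -/

/-! ### Integrals over rectangles. -/

theorem rectIntegral_iUnion {ι κ : Type*} [Fintype ι] [Fintype κ] {h : SquareFun}
    (hh : Integrable (Function.uncurry h) volume) {E : ι → Set unitInterval}
    {F : κ → Set unitInterval} (hE : ∀ i, MeasurableSet (E i)) (hF : ∀ i, MeasurableSet (F i))
    (hEd : Pairwise (Function.onFun Disjoint E)) (hFd : Pairwise (Function.onFun Disjoint F)) :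
    rectIntegral h (⋃ i, E i) (⋃ j, F j) = ∑ i, ∑ j, rectIntegral h (E i) (F j) := by
  unfold rectIntegral
  have : (⋃ i, E i) ×ˢ (⋃ j, F j) = ⋃ p : ι × κ, E p.1 ×ˢ F p.2 := by
    ext ⟨x, y⟩; simp
  rw [this, integral_iUnion_fintype, Fintype.sum_prod_type]
  · exact fun p => (hE _).prod (hF _)
  · rintro ⟨i, j⟩ ⟨i', j'⟩ hne
    rw [Function.onFun, Set.disjoint_prod]
    by_cases hi : i = i'
    · right; apply hFd; rintro rfl; exact hne (by rw [hi])
    · left; exact hEd hi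
  · exact fun p => hh.integrableOn

theorem rectIntegral_left_diff {h : SquareFun} (hh : Integrable (Function.uncurry h) volume)
    {S U T : Set unitInterval} (hU : MeasurableSet U) (hT : MeasurableSet T) (hUS : U ⊆ S) :
    rectIntegral h (S \ U) T = rectIntegral h S T - rectIntegral h U T := by
  unfold rectIntegral
  have : (S \ U) ×ˢ T = S ×ˢ T \ U ×ˢ T := by ext; simp; tauto
  rw [this]
  exact setIntegral_sdiff (hU.prod hT) hh.integrableOn (Set.prod_mono hUS le_rfl)

theorem rectIntegral_right_diff {h : SquareFun} (hh : Integrable (Function.uncurry h) volume)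
    {S U T : Set unitInterval} (hU : MeasurableSet U) (hS : MeasurableSet S) (hUT : U ⊆ T) :
    rectIntegral h S (T \ U) = rectIntegral h S T - rectIntegral h S U := by
  unfold rectIntegral
  have : S ×ˢ (T \ U) = S ×ˢ T \ S ×ˢ U := by ext; simp; tauto
  rw [this]
  exact setIntegral_sdiff (hS.prod hU) hh.integrableOn (Set.prod_mono le_rfl hUT)

theorem volume_real_prod (S T : Set unitInterval) :
    volume.real (S ×ˢ T) = volume.real S * volume.real T := by
  rw [Measure.volume_eq_prod, measureReal_prod_prod]

theorem abs_rectIntegral_le {h : SquareFun} {C : ℝ}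
    (hC : ∀ᵐ p, |Function.uncurry h p| ≤ C) (S T : Set unitInterval) :
    |rectIntegral h S T| ≤ C * (volume.real S * volume.real T) := by
  rw [← volume_real_prod]
  exact norm_setIntegral_le_of_norm_le_const_ae (f := Function.uncurry h) (measure_lt_top _ _)
    (ae_restrict_of_ae hC)

theorem rectIntegral_swap {h : SquareFun} (hs : ∀ x y, h x y = h y x) (S T : Set unitInterval) :
    rectIntegral h S T = rectIntegral h T S := by
  unfold rectIntegral
  rw [Measure.volume_eq_prod, ← setIntegral_prod_swap]
  simp only [Prod.fst_swap, Prod.snd_swap]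
  congr 1; ext p; exact hs _ _

theorem rectIntegral_sub {f g : SquareFun} (hf : Integrable (Function.uncurry f) volume)
    (hg : Integrable (Function.uncurry g) volume) (S T : Set unitInterval) :
    rectIntegral (f - g) S T = rectIntegral f S T - rectIntegral g S T := by
  unfold rectIntegral
  exact integral_sub hf.integrableOn hg.integrableOn

theorem rectIntegral_mono_const {h : SquareFun} (hh : Integrable (Function.uncurry h) volume)
    {S T : Set unitInterval} (hS : MeasurableSet S) (hT : MeasurableSet T) {a b : ℝ}
    (ha : ∀ x ∈ S, ∀ y ∈ T, a ≤ h x y) (hb : ∀ x ∈ S, ∀ y ∈ T, h x y ≤ b) :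
    a * (volume.real S * volume.real T) ≤ rectIntegral h S T ∧
      rectIntegral h S T ≤ b * (volume.real S * volume.real T) := by
  have hc (c : ℝ) : c * (volume.real S * volume.real T) = ∫ p in S ×ˢ T, c := by
    rw [setIntegral_const, volume_real_prod, smul_eq_mul, mul_comm]
  rw [hc, hc]
  unfold rectIntegral
  constructor
  · exact setIntegral_mono_on (integrableOn_const (measure_ne_top _ _)) hh.integrableOn
      (hS.prod hT) (fun p hp => ha _ hp.1 _ hp.2)
  · exact setIntegral_mono_on hh.integrableOn (integrableOn_const (measure_ne_top _ _))
      (hS.prod hT) (fun p hp => hb _ hp.1 _ hp.2)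

/-! ### Cutting sets into pieces of prescribed measure. -/

/-- The function `t ↦ |S ∩ [0,t]|` is 1-Lipschitz, so the intermediate value theorem applies. -/
theorem exists_volume_inter_Iic_eq {S : Set unitInterval} {β : ℝ}
    (h0 : 0 ≤ β) (hβ : β ≤ volume.real S) : ∃ t, volume.real (S ∩ Set.Iic t) = β := by
  have key (s t : unitInterval) : volume.real (S ∩ Set.Iic t) ≤
      volume.real (S ∩ Set.Iic s) + 1 * dist t s := by
    have hsub : S ∩ Set.Iic t ⊆ (S ∩ Set.Iic s) ∪ Set.uIoc t s := by
      rintro x ⟨hx, hxt⟩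
      by_cases hxs : x ≤ s
      · exact Or.inl ⟨hx, hxs⟩
      · right; rw [Set.mem_uIoc]; right; exact ⟨not_le.1 hxs, hxt⟩
    calc _ ≤ volume.real ((S ∩ Set.Iic s) ∪ Set.uIoc t s) := measureReal_mono hsub
      _ ≤ _ := measureReal_union_le _ _
      _ = _ := by
        congr 1
        rw [measureReal_def, unitInterval.volume_uIoc, one_mul, edist_dist,
          ENNReal.toReal_ofReal dist_nonneg, dist_comm]
  have hcont : Continuous (fun t : unitInterval => volume.real (S ∩ Set.Iic t)) := by
    apply LipschitzWith.continuous (K := 1)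
    apply LipschitzWith.of_le_add_mul
    intro s t
    simpa using key t s
  have := intermediate_value_univ (0 : unitInterval) 1 hcont
  apply this
  constructor
  · have : volume.real (S ∩ Set.Iic (0 : unitInterval)) = 0 := by
      refine measureReal_mono_null (Set.inter_subset_right (t := Set.Iic (0 : unitInterval))) ?_
      simp [measureReal_def]
    simpa [this] using h0
  · have : S ∩ Set.Iic (1 : unitInterval) = S := by
      ext x; simp [unitInterval.le_one']
    simpa [this] using hβ

theorem exists_pieces (β : ℝ) (h0 : 0 ≤ β) (N : ℕ) : ∀ S : Set unitInterval, MeasurableSet S →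
    N * β ≤ volume.real S → ∃ E : Fin N → Set unitInterval, (∀ k, MeasurableSet (E k)) ∧
      (∀ k, E k ⊆ S) ∧ (∀ k, volume.real (E k) = β) ∧ Pairwise (Function.onFun Disjoint E) := by
  induction N with
  | zero => exact fun S _ _ => ⟨fun _ => ∅, by simp, by simp, fun k => k.elim0, fun k => k.elim0⟩
  | succ N ih =>
    intro S hS hN
    push_cast at hN
    have hNβ : 0 ≤ N * β := by positivity
    obtain ⟨t, ht⟩ := exists_volume_inter_Iic_eq (S := S) h0 (by linarith)
    have hm : MeasurableSet (S ∩ Set.Iic t) := hS.inter measurableSet_Iic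
    obtain ⟨E, hE, hES, hEβ, hEd⟩ := ih (S \ (S ∩ Set.Iic t)) (hS.diff hm) (by
      rw [measureReal_sdiff Set.inter_subset_left hm, ht]; linarith)
    have hdis (k) : Disjoint (S ∩ Set.Iic t) (E k) :=
      Set.disjoint_of_subset_right (hES k) Set.disjoint_sdiff_right
    refine ⟨Fin.cons (S ∩ Set.Iic t) E, ?_, ?_, ?_, ?_⟩
    · intro k; refine Fin.cases hm hE k
    · intro k; refine Fin.cases Set.inter_subset_left (fun k => (hES k).trans Set.sdiff_subset) k
    · intro k; refine Fin.cases ht hEβ k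
    · intro k l
      refine Fin.cases ?_ (fun k => ?_) k <;> refine Fin.cases ?_ (fun l => ?_) l
      · simp
      · intro _; exact hdis l
      · intro _; exact (hdis k).symm
      · intro hkl; exact hEd (fun h => hkl (congrArg Fin.succ h))

/-! ### The uniform grid and pieces subordinate to it. -/

/-- The half-open interval `[i/n, (i+1)/n)` inside `[0,1]`. -/
def gridCell (n i : ℕ) : Set unitInterval :=
  {x | (i : ℝ) / n ≤ x ∧ (x : ℝ) < ((i + 1 : ℕ) : ℝ) / n}

theorem measurableSet_gridCell (n i : ℕ) : MeasurableSet (gridCell n i) :=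
  (measurableSet_le measurable_const measurable_subtype_coe).inter
    (measurableSet_lt measurable_subtype_coe measurable_const)

/-- The grid point `k/n`, clamped to `[0,1]`. -/
noncomputable def gridPoint (n k : ℕ) : unitInterval := Set.projIcc 0 1 zero_le_one ((k : ℝ) / n)

theorem coe_gridPoint {n k : ℕ} (hk : k ≤ n) : (gridPoint n k : ℝ) = k / n := by
  unfold gridPoint
  rw [Set.projIcc_of_mem zero_le_one
    ⟨by positivity, div_le_one_of_le₀ (by exact_mod_cast hk) (by positivity)⟩]

theorem gridPoint_mono (n : ℕ) : Monotone (gridPoint n) := fun k l h =>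
  Set.monotone_projIcc _ (by gcongr)

theorem volume_gridCell_le {n i : ℕ} (hi : i < n) :
    volume.real (gridCell n i) ≤ 1 / n := by
  have hsub : gridCell n i ⊆ Set.Icc (gridPoint n i) (gridPoint n (i + 1)) := by
    rintro x ⟨h1, h2⟩
    constructor
    · rw [← Subtype.coe_le_coe, coe_gridPoint hi.le]; exact h1
    · rw [← Subtype.coe_le_coe, coe_gridPoint hi]; exact h2.le
  refine (measureReal_mono hsub).trans ?_
  rw [measureReal_def, unitInterval.volume_Icc, coe_gridPoint hi.le, coe_gridPoint hi,
    ENNReal.toReal_ofReal]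
  · push_cast; apply le_of_eq; ring
  · push_cast; rw [add_div]; have : (0 : ℝ) ≤ 1 / n := by positivity
    linarith

theorem disjoint_gridCell {n i j : ℕ} (h : i ≠ j) :
    Disjoint (gridCell n i) (gridCell n j) := by
  rw [Set.disjoint_left]
  rintro x ⟨h1, h2⟩ ⟨h3, h4⟩
  rcases Nat.eq_zero_or_pos n with rfl | hn
  · simp at h1 h2; linarith
  have hn' : (0 : ℝ) < n := by exact_mod_cast hn
  rw [div_le_iff₀ hn'] at h1 h3
  rw [lt_div_iff₀ hn'] at h2 h4
  have a1 : (i : ℝ) < ((j + 1 : ℕ) : ℝ) := by linarith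
  have a2 : (j : ℝ) < ((i + 1 : ℕ) : ℝ) := by linarith
  have b1 := Nat.cast_lt.1 a1
  have b2 := Nat.cast_lt.1 a2
  omega

theorem exists_mem_gridCell {n : ℕ} (hn : 0 < n) {x : unitInterval} (hx : x ≠ 1) :
    ∃ i : Fin n, x ∈ gridCell n i := by
  have hn' : (0 : ℝ) < n := by exact_mod_cast hn
  have hx1 : (x : ℝ) < 1 := unitInterval.lt_one_iff_ne_one.2 hx
  have h0 : 0 ≤ (x : ℝ) * n := mul_nonneg x.2.1 hn'.le
  refine ⟨⟨⌊(x : ℝ) * n⌋₊, ?_⟩, ?_, ?_⟩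
  · rw [Nat.floor_lt h0]; nlinarith
  · rw [div_le_iff₀ hn']; exact Nat.floor_le h0
  · rw [lt_div_iff₀ hn']; push_cast; exact Nat.lt_floor_add_one _

/-- In each of the `n` grid intervals as many pieces as possible are cut off, so less than one piece
of measure `α` is left over there. -/
theorem exists_grid_pieces {S : Set unitInterval} (hS : MeasurableSet S) {n : ℕ} (hn : 0 < n)
    {α : ℝ} (hα : 0 < α) :
    ∃ (N : Fin n → ℕ) (E : (Σ i, Fin (N i)) → Set unitInterval), (∀ a, MeasurableSet (E a)) ∧
      (∀ a, E a ⊆ S) ∧ (∀ a, E a ⊆ gridCell n a.1) ∧ (∀ a, volume.real (E a) = α) ∧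
      Pairwise (Function.onFun Disjoint E) ∧ (∀ i, N i * α ≤ 1 / n) ∧
      volume.real (S \ ⋃ a, E a) ≤ n * α := by
  let V : Fin n → Set unitInterval := fun i => S ∩ gridCell n i
  let N : Fin n → ℕ := fun i => ⌊volume.real (V i) / α⌋₊
  have hV i : MeasurableSet (V i) := hS.inter (measurableSet_gridCell n i)
  have hN i : N i * α ≤ volume.real (V i) := by
    rw [← le_div_iff₀ hα]; exact Nat.floor_le (by positivity)
  choose E hE hEV hEα hEd using fun i => exists_pieces α hα.le (N i) (V i) (hV i) (hN i)
  refine ⟨N, fun a => E a.1 a.2, fun a => hE _ _, fun a => (hEV _ _).trans Set.inter_subset_left,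
    fun a => (hEV _ _).trans Set.inter_subset_right, fun a => hEα _ _, ?_, ?_, ?_⟩
  · rintro ⟨i, k⟩ ⟨j, l⟩ hne
    by_cases hij : i = j
    · subst hij
      exact hEd i (fun h => hne (congrArg (Sigma.mk i) h))
    · refine Set.disjoint_of_subset ((hEV _ _).trans Set.inter_subset_right)
        ((hEV _ _).trans Set.inter_subset_right) (disjoint_gridCell ?_)
      exact fun h => hij (Fin.ext h)
  · intro i
    exact (hN i).trans ((measureReal_mono Set.inter_subset_right).trans (volume_gridCell_le i.2))
  -- The point `1` lies in no half-open grid interval; it is a null set.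
  · have hsub : (S \ ⋃ a : Σ i, Fin (N i), E a.1 a.2) ⊆
        {1} ∪ ⋃ i, (V i \ ⋃ k, E i k) := by
      rintro x ⟨hxS, hx⟩
      by_cases hx1 : x = 1
      · left; exact hx1
      · right
        obtain ⟨i, hi⟩ := exists_mem_gridCell hn hx1
        rw [Set.mem_iUnion]
        refine ⟨i, ⟨hxS, hi⟩, fun hk => hx ?_⟩
        rw [Set.mem_iUnion] at hk ⊢
        exact ⟨⟨i, hk.choose⟩, hk.choose_spec⟩
    refine (measureReal_mono hsub).trans ((measureReal_union_le _ _).trans ?_)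
    have h1 : volume.real ({1} : Set unitInterval) = 0 := by simp [measureReal_def]
    rw [h1, zero_add]
    refine (measureReal_iUnion_fintype_le _).trans ?_
    have : ∀ i, volume.real (V i \ ⋃ k, E i k) ≤ α := by
      intro i
      rw [measureReal_sdiff (Set.iUnion_subset (hEV i)) (MeasurableSet.iUnion (hE i)),
        measureReal_iUnion_fintype (hEd i) (hE i)]
      simp only [hEα, Finset.sum_const, Finset.card_univ, Fintype.card_fin, nsmul_eq_mul]
      have := Nat.lt_floor_add_one (volume.real (V i) / α)
      rw [div_lt_iff₀ hα] at this
      change _ < ((N i : ℝ) + 1) * α at this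
      linarith
    refine (Finset.sum_le_sum fun i _ => this i).trans ?_
    simp

/-! ### The cut norm estimate from two-sided cell comparison. -/

/-- `R` agrees in the interior of the square with a function `g`, monotone in the first and antitone
in the second variable, that compares up to `ε` with the averages of `f` over `α × α` cells. -/
structure IsCellApprox (f R g : SquareFun) (M α ε : ℝ) : Prop where
  integrable_left : Integrable (Function.uncurry f) volume
  symm_left : ∀ x y, f x y = f y x
  bound_left : ∀ᵐ p, |Function.uncurry f p| ≤ M
  integrable_right : Integrable (Function.uncurry R) volume
  symm_right : ∀ x y, R x y = R y x
  bound_right : ∀ x y, |R x y| ≤ M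
  bound : ∀ x y, |g x y| ≤ M
  mono : ∀ ⦃x x' y y'⦄, x ≤ x' → y' ≤ y → g x y ≤ g x' y'
  eq_of_le : ∀ x y : unitInterval, x ≤ y → α ≤ x → (y : ℝ) ≤ 1 - α → R x y = g x y
  pos : 0 < α
  nonneg : 0 ≤ ε
  le_of_subset : ∀ (x y : unitInterval) (P Q : Set unitInterval), MeasurableSet P →
    MeasurableSet Q → volume.real P = α → volume.real Q = α → P ⊆ Set.Iic x → Q ⊆ Set.Ici y →
    rectIntegral f P Q ≤ g x y * (α * α)
  le_add_of_subset : ∀ (x y : unitInterval) (P Q : Set unitInterval), MeasurableSet P →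
    MeasurableSet Q → volume.real P = α → volume.real Q = α → P ⊆ Set.Ici x → Q ⊆ Set.Iic y →
    SetLE P Q → g x y * (α * α) ≤ rectIntegral f P Q + ε * (α * α)

/-- The oscillation of `g` between opposite corners of a grid block. -/
noncomputable def blockOsc (g : SquareFun) (n i j : ℕ) : ℝ :=
  g (gridPoint n (i + 1)) (gridPoint n j) - g (gridPoint n i) (gridPoint n (j + 1))

/-- Counts how often the block `(i, j)` of an `n × n` grid is diagonal or in a boundary strip. -/
def exceptional (n i j : ℕ) : ℝ :=
  (if i = j then 1 else 0) + (if i = 0 then 1 else 0) + (if i = n - 1 then 1 else 0) +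
    (if j = 0 then 1 else 0) + (if j = n - 1 then 1 else 0)

theorem exceptional_nonneg (n i j : ℕ) : 0 ≤ exceptional n i j := by
  unfold exceptional; positivity

theorem one_le_exceptional {n i j : ℕ}
    (h : i = j ∨ i = 0 ∨ i = n - 1 ∨ j = 0 ∨ j = n - 1) : 1 ≤ exceptional n i j := by
  have h1 (p : Prop) [Decidable p] : (0 : ℝ) ≤ if p then 1 else 0 := by positivity
  have a1 := h1 (i = j)
  have a2 := h1 (i = 0)
  have a3 := h1 (i = n - 1)
  have a4 := h1 (j = 0)
  have a5 := h1 (j = n - 1)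
  unfold exceptional
  rcases h with h | h | h | h | h <;> rw [if_pos h] at * <;> linarith

/-- The diagonal and each of the four boundary strips contribute at most `n`. -/
theorem sum_exceptional_le {n : ℕ} (hn : 0 < n) :
    ∑ i ∈ Finset.range n, ∑ j ∈ Finset.range n, exceptional n i j ≤ 5 * n := by
  have h1 (k : ℕ) : (∑ i ∈ Finset.range n, if i = k then (1 : ℝ) else 0) ≤ 1 := by
    rw [Finset.sum_ite_eq']; split_ifs <;> norm_num
  have h2 (k : ℕ) : (∑ i ∈ Finset.range n, if k = i then (1 : ℝ) else 0) ≤ 1 := by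
    rw [Finset.sum_ite_eq]; split_ifs <;> norm_num
  have e : ∑ i ∈ Finset.range n, ∑ j ∈ Finset.range n, exceptional n i j =
      (∑ i ∈ Finset.range n, ∑ j ∈ Finset.range n, if i = j then (1 : ℝ) else 0) +
      n * (∑ i ∈ Finset.range n, if i = 0 then (1 : ℝ) else 0) +
      n * (∑ i ∈ Finset.range n, if i = n - 1 then (1 : ℝ) else 0) +
      n * (∑ i ∈ Finset.range n, if i = 0 then (1 : ℝ) else 0) +
      n * (∑ i ∈ Finset.range n, if i = n - 1 then (1 : ℝ) else 0) := by
    simp only [exceptional, Finset.sum_add_distrib, Finset.sum_const, Finset.card_range,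
      nsmul_eq_mul, Finset.mul_sum]
  have h3 : (∑ i ∈ Finset.range n, ∑ j ∈ Finset.range n, if i = j then (1 : ℝ) else 0) ≤ n := by
    refine (Finset.sum_le_sum fun i _ => h2 i).trans ?_
    simp
  have hn' : (0 : ℝ) ≤ n := by positivity
  have := mul_le_mul_of_nonneg_left (h1 0) hn'
  have := mul_le_mul_of_nonneg_left (h1 (n - 1)) hn'
  rw [e]; linarith

/-- The oscillation is a horizontal plus a vertical increment. Each telescopes along its `n` lines
to at most `2 * M` per line. -/
theorem sum_blockOsc_le {g : SquareFun} {M : ℝ} (hg : ∀ x y, |g x y| ≤ M) (n : ℕ) :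
    ∑ i ∈ Finset.range n, ∑ j ∈ Finset.range n, blockOsc g n i j ≤ 4 * M * n := by
  let G : ℕ → ℕ → ℝ := fun i j => g (gridPoint n i) (gridPoint n j)
  have e : ∑ i ∈ Finset.range n, ∑ j ∈ Finset.range n, blockOsc g n i j =
      (∑ j ∈ Finset.range n, ∑ i ∈ Finset.range n, (G (i + 1) j - G i j)) +
      ∑ i ∈ Finset.range n, ∑ j ∈ Finset.range n, (G i j - G i (j + 1)) := by
    rw [Finset.sum_comm (f := fun j i => G (i + 1) j - G i j), ← Finset.sum_add_distrib]
    refine Finset.sum_congr rfl fun i _ => ?_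
    rw [← Finset.sum_add_distrib]
    refine Finset.sum_congr rfl fun j _ => ?_
    simp only [blockOsc, G]; ring
  have h2 (i j k l) : G i j - G k l ≤ 2 * M := by
    have a := (abs_le.1 (hg (gridPoint n i) (gridPoint n j))).2
    have b := (abs_le.1 (hg (gridPoint n k) (gridPoint n l))).1
    simp only [G]; linarith
  have h3 : (∑ j ∈ Finset.range n, ∑ i ∈ Finset.range n, (G (i + 1) j - G i j)) ≤
      ∑ j ∈ Finset.range n, 2 * M := by
    refine Finset.sum_le_sum fun j _ => ?_
    rw [Finset.sum_range_sub (fun i => G i j)]; exact h2 _ _ _ _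
  have h4 : (∑ i ∈ Finset.range n, ∑ j ∈ Finset.range n, (G i j - G i (j + 1))) ≤
      ∑ j ∈ Finset.range n, 2 * M := by
    refine Finset.sum_le_sum fun i _ => ?_
    rw [Finset.sum_range_sub' (fun j => G i j)]; exact h2 _ _ _ _
  simp only [Finset.sum_const, Finset.card_range, nsmul_eq_mul] at h3 h4
  rw [e]; linarith

namespace IsCellApprox

variable {f R g : SquareFun} {M α ε : ℝ}

theorem M_nonneg (H : IsCellApprox f R g M α ε) : 0 ≤ M :=
  (abs_nonneg _).trans (H.bound 0 0)

theorem blockOsc_nonneg (H : IsCellApprox f R g M α ε) (n i j : ℕ) : 0 ≤ blockOsc g n i j :=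
  sub_nonneg.2 (H.mono (gridPoint_mono n (by omega)) (gridPoint_mono n (by omega)))

theorem integrable_sub (H : IsCellApprox f R g M α ε) :
    Integrable (Function.uncurry (f - R)) volume :=
  H.integrable_left.sub H.integrable_right

theorem symm_sub (H : IsCellApprox f R g M α ε) (x y : unitInterval) :
    (f - R) x y = (f - R) y x := by
  simp only [Pi.sub_apply, H.symm_left x y, H.symm_right x y]

theorem abs_rectIntegral_le_two (H : IsCellApprox f R g M α ε) (S T : Set unitInterval) :
    |rectIntegral (f - R) S T| ≤ 2 * M * (volume.real S * volume.real T) := by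
  apply abs_rectIntegral_le
  filter_upwards [H.bound_left] with p hp
  have h1 := H.bound_right p.1 p.2
  have : |f p.1 p.2 - R p.1 p.2| ≤ |f p.1 p.2| + |R p.1 p.2| := abs_sub _ _
  change |f p.1 p.2| ≤ M at hp
  change |f p.1 p.2 - R p.1 p.2| ≤ _
  linarith

/-- The values of `g` at the upper left and lower right corners of the block enclose both `R` and,
up to `ε`, the average of `f`. The conditions `i ≠ 0`, `j ≠ n - 1` and `α ≤ 1 / n` keep the block
inside the region where `R = g`. -/
theorem abs_rectIntegral_block_le (H : IsCellApprox f R g M α ε) {n i j : ℕ} (hn : 0 < n)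
    (hαn : α ≤ 1 / n) (hij : i < j) (hi : i ≠ 0) (hj : j < n) (hj' : j ≠ n - 1)
    {P Q : Set unitInterval} (hP : MeasurableSet P) (hQ : MeasurableSet Q)
    (hPi : P ⊆ gridCell n i) (hQj : Q ⊆ gridCell n j) (hPα : volume.real P = α)
    (hQα : volume.real Q = α) :
    |rectIntegral (f - R) P Q| ≤ α * α * (blockOsc g n i j + ε) := by
  have hn' : (0 : ℝ) < n := by exact_mod_cast hn
  have hPl : P ⊆ Set.Ici (gridPoint n i) := fun x hx => by
    rw [Set.mem_Ici, ← Subtype.coe_le_coe, coe_gridPoint (by omega)]; exact (hPi hx).1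
  have hPu : P ⊆ Set.Iic (gridPoint n (i + 1)) := fun x hx => by
    rw [Set.mem_Iic, ← Subtype.coe_le_coe, coe_gridPoint (by omega)]; exact (hPi hx).2.le
  have hQl : Q ⊆ Set.Ici (gridPoint n j) := fun x hx => by
    rw [Set.mem_Ici, ← Subtype.coe_le_coe, coe_gridPoint (by omega)]; exact (hQj hx).1
  have hQu : Q ⊆ Set.Iic (gridPoint n (j + 1)) := fun x hx => by
    rw [Set.mem_Iic, ← Subtype.coe_le_coe, coe_gridPoint (by omega)]; exact (hQj hx).2.le
  have hPQ : SetLE P Q := fun x hx y hy =>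
    (hPu hx).trans ((gridPoint_mono n (by omega : i + 1 ≤ j)).trans (hQl hy))
  have hu := H.le_of_subset _ _ P Q hP hQ hPα hQα hPu hQl
  have hl := H.le_add_of_subset _ _ P Q hP hQ hPα hQα hPl hQu hPQ
  have hRg : ∀ x ∈ P, ∀ y ∈ Q, R x y = g x y := by
    intro x hx y hy
    apply H.eq_of_le x y (hPQ x hx y hy)
    · refine hαn.trans (le_trans ?_ (hPi hx).1)
      have : (1 : ℝ) ≤ i := by exact_mod_cast Nat.one_le_iff_ne_zero.2 hi
      gcongr
    · refine (hQj hy).2.le.trans ?_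
      have : ((j + 1 : ℕ) : ℝ) ≤ n - 1 := by
        rw [le_sub_iff_add_le]; exact_mod_cast (by omega : j + 1 + 1 ≤ n)
      have h2 : ((j + 1 : ℕ) : ℝ) / n ≤ (n - 1) / n := by gcongr
      rw [sub_div, div_self hn'.ne'] at h2
      linarith
  have hR := rectIntegral_mono_const H.integrable_right hP hQ
    (a := g (gridPoint n i) (gridPoint n (j + 1))) (b := g (gridPoint n (i + 1)) (gridPoint n j))
    (fun x hx y hy => by rw [hRg x hx y hy]; exact H.mono (hPl hx) (hQu hy))
    (fun x hx y hy => by rw [hRg x hx y hy]; exact H.mono (hPu hx) (hQl hy))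
  rw [hPα, hQα] at hR
  have hε : 0 ≤ ε * (α * α) := mul_nonneg H.nonneg (mul_nonneg H.pos.le H.pos.le)
  rw [rectIntegral_sub H.integrable_left H.integrable_right, abs_le]
  unfold blockOsc
  constructor <;> linarith [hR.1, hR.2]

/-- Exceptional blocks get the trivial bound `2 * M`. Blocks below the diagonal are reflected, which
is why `blockOsc` occurs in both index orders. -/
theorem abs_rectIntegral_piece_le (H : IsCellApprox f R g M α ε) {n i j : ℕ} (hn : 0 < n)
    (hαn : α ≤ 1 / n) (hi : i < n) (hj : j < n)
    {P Q : Set unitInterval} (hP : MeasurableSet P) (hQ : MeasurableSet Q)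
    (hPi : P ⊆ gridCell n i) (hQj : Q ⊆ gridCell n j) (hPα : volume.real P = α)
    (hQα : volume.real Q = α) :
    |rectIntegral (f - R) P Q| ≤
      α * α * (2 * M * exceptional n i j + blockOsc g n i j + blockOsc g n j i + ε) := by
  have h1 := H.blockOsc_nonneg n i j
  have h2 := H.blockOsc_nonneg n j i
  have h3 : 0 ≤ 2 * M * exceptional n i j :=
    mul_nonneg (by linarith [H.M_nonneg]) (exceptional_nonneg _ _ _)
  have hαα : 0 ≤ α * α := mul_nonneg H.pos.le H.pos.le
  by_cases hb : i = j ∨ i = 0 ∨ i = n - 1 ∨ j = 0 ∨ j = n - 1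
  · refine (H.abs_rectIntegral_le_two P Q).trans ?_
    rw [hPα, hQα, mul_comm]
    refine mul_le_mul_of_nonneg_left ?_ hαα
    have := mul_le_mul_of_nonneg_left (one_le_exceptional hb)
      (by linarith [H.M_nonneg] : 0 ≤ 2 * M)
    linarith [H.nonneg]
  · push Not at hb
    obtain ⟨b1, b2, b3, b4, b5⟩ := hb
    rcases lt_or_gt_of_ne b1 with hij | hij
    · refine (H.abs_rectIntegral_block_le hn hαn hij b2 hj b5 hP hQ hPi hQj hPα hQα).trans ?_
      exact mul_le_mul_of_nonneg_left (by linarith) hαα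
    · rw [rectIntegral_swap H.symm_sub]
      refine (H.abs_rectIntegral_block_le hn hαn hij b4 hi b3 hQ hP hQj hPi hQα hPα).trans ?_
      exact mul_le_mul_of_nonneg_left (by linarith) hαα

/-- The leftovers of `S` and of `T` cost `2 * M * (n * α)` each. The constant `18` is `2 · 5` from
exceptional blocks plus `2 · 4` from the two oscillation sums. -/
theorem abs_rectIntegral_sub_le_grid (H : IsCellApprox f R g M α ε) {n : ℕ} (hn : 0 < n)
    (hαn : α ≤ 1 / n) {S T : Set unitInterval} (hS : MeasurableSet S) (hT : MeasurableSet T) :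
    |rectIntegral (f - R) S T| ≤ 4 * M * (n * α) + 18 * M / n + ε := by
  have hn' : (0 : ℝ) < n := by exact_mod_cast hn
  have hM := H.M_nonneg
  obtain ⟨N, E, hE, hES, hEg, hEα, hEd, hN, hEr⟩ := exists_grid_pieces hS hn H.pos
  obtain ⟨K, F, hF, hFT, hFg, hFα, hFd, hK, hFr⟩ := exists_grid_pieces hT hn H.pos
  set U := ⋃ a, E a with hU
  set V := ⋃ b, F b with hV
  have hUm : MeasurableSet U := MeasurableSet.iUnion hE
  have hVm : MeasurableSet V := MeasurableSet.iUnion hF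
  have hUS : U ⊆ S := Set.iUnion_subset hES
  have hVT : V ⊆ T := Set.iUnion_subset hFT
  have e1 := rectIntegral_left_diff H.integrable_sub hUm hT hUS
  have e2 := rectIntegral_right_diff H.integrable_sub hVm hUm hVT
  have b1 : |rectIntegral (f - R) (S \ U) T| ≤ 2 * M * (n * α) := by
    refine (H.abs_rectIntegral_le_two _ _).trans ?_
    have : volume.real (S \ U) * volume.real T ≤ n * α * 1 :=
      mul_le_mul hEr measureReal_le_one (by positivity) (by have := H.pos; positivity)
    rw [mul_one] at this
    exact mul_le_mul_of_nonneg_left this (by positivity)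
  have b2 : |rectIntegral (f - R) U (T \ V)| ≤ 2 * M * (n * α) := by
    refine (H.abs_rectIntegral_le_two _ _).trans ?_
    have : volume.real U * volume.real (T \ V) ≤ 1 * (n * α) :=
      mul_le_mul measureReal_le_one hFr (by positivity) (by norm_num)
    rw [one_mul] at this
    exact mul_le_mul_of_nonneg_left this (by positivity)
  let B : ℕ → ℕ → ℝ := fun i j =>
    2 * M * exceptional n i j + blockOsc g n i j + blockOsc g n j i + ε
  have hB i j : 0 ≤ B i j := by
    have h1 := H.blockOsc_nonneg n i j
    have h2 := H.blockOsc_nonneg n j i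
    have h3 : 0 ≤ 2 * M * exceptional n i j := mul_nonneg (by linarith) (exceptional_nonneg _ _ _)
    have := H.nonneg
    simp only [B]; linarith
  have b3 : |rectIntegral (f - R) U V| ≤
      ∑ i ∈ Finset.range n, ∑ j ∈ Finset.range n, 1 / n * (1 / n) * B i j := by
    rw [rectIntegral_iUnion H.integrable_sub hE hF hEd hFd]
    calc _ ≤ ∑ a, ∑ b, |rectIntegral (f - R) (E a) (F b)| :=
          (Finset.abs_sum_le_sum_abs _ _).trans
            (Finset.sum_le_sum fun a _ => Finset.abs_sum_le_sum_abs _ _)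
      _ ≤ ∑ a : Σ i, Fin (N i), ∑ b : Σ j, Fin (K j), α * α * B a.1 b.1 :=
          Finset.sum_le_sum fun a _ => Finset.sum_le_sum fun b _ =>
            H.abs_rectIntegral_piece_le hn hαn a.1.2 b.1.2 (hE a) (hF b) (hEg a) (hFg b)
              (hEα a) (hFα b)
      _ = ∑ i : Fin n, ∑ j : Fin n, (N i * α) * (K j * α) * B i j := by
          simp only [Fintype.sum_sigma, Finset.sum_const, Finset.card_univ, Fintype.card_fin,
            nsmul_eq_mul, Finset.mul_sum]
          refine Finset.sum_congr rfl fun i _ => Finset.sum_congr rfl fun j _ => by ring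
      -- The disjoint pieces in one grid interval have total measure at most `1 / n`.
      _ ≤ ∑ i : Fin n, ∑ j : Fin n, 1 / n * (1 / n) * B i j := by
          refine Finset.sum_le_sum fun i _ => Finset.sum_le_sum fun j _ => ?_
          refine mul_le_mul_of_nonneg_right ?_ (hB _ _)
          have := H.pos
          exact mul_le_mul (hN i) (hK j) (by positivity) (by positivity)
      _ = _ := by
          rw [Finset.sum_range]
          refine Finset.sum_congr rfl fun i _ => ?_
          rw [Finset.sum_range]
  have b4 : ∑ i ∈ Finset.range n, ∑ j ∈ Finset.range n, B i j ≤
      18 * M * n + n * n * ε := by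
    simp only [B, Finset.sum_add_distrib, Finset.sum_const, Finset.card_range, nsmul_eq_mul,
      ← Finset.mul_sum]
    rw [Finset.sum_comm (f := fun i j => blockOsc g n j i)]
    have c1 := sum_blockOsc_le H.bound n
    have c2 := mul_le_mul_of_nonneg_left (sum_exceptional_le hn) (by linarith : 0 ≤ 2 * M)
    linarith
  have b5 : |rectIntegral (f - R) U V| ≤ 18 * M / n + ε := by
    refine b3.trans ?_
    simp only [← Finset.mul_sum]
    refine (mul_le_mul_of_nonneg_left b4 (by positivity)).trans (le_of_eq ?_)
    field_simp
  have : rectIntegral (f - R) S T = rectIntegral (f - R) (S \ U) T +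
      rectIntegral (f - R) U (T \ V) + rectIntegral (f - R) U V := by linarith
  rw [this]
  refine (abs_add_three _ _ _).trans ?_
  linarith

/-- The choice `n = ⌊1 / √α⌋₊` balances `n * α` against `1 / n`, giving `4 + 18 · 2 = 40`. For `√α ≥
1` the trivial bound `2 * M` suffices. -/
theorem abs_rectIntegral_sub_le (H : IsCellApprox f R g M α ε) {S T : Set unitInterval}
    (hS : MeasurableSet S) (hT : MeasurableSet T) :
    |rectIntegral (f - R) S T| ≤ 40 * (M * √α) + ε := by
  have hM := H.M_nonneg
  have hs : 0 < √α := Real.sqrt_pos.2 H.pos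
  rcases le_or_gt 1 √α with h1 | h1
  · refine (H.abs_rectIntegral_le_two S T).trans ?_
    have h2 : volume.real S * volume.real T ≤ 1 :=
      mul_le_one₀ measureReal_le_one (by positivity) measureReal_le_one
    have h3 := mul_le_mul_of_nonneg_left h2 (by linarith : 0 ≤ 2 * M)
    have h4 := mul_le_mul_of_nonneg_left h1 hM
    linarith [H.nonneg]
  · have hss : √α * √α = α := Real.mul_self_sqrt H.pos.le
    have h1' : 1 ≤ 1 / √α := by rw [le_div_iff₀ hs]; linarith
    have hn : 0 < ⌊1 / √α⌋₊ := Nat.floor_pos.2 h1'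
    set n := ⌊1 / √α⌋₊ with hndef
    have hn' : (1 : ℝ) ≤ n := by exact_mod_cast hn
    have hle : (n : ℝ) ≤ 1 / √α := Nat.floor_le (by positivity)
    have hlt : 1 / √α < n + 1 := Nat.lt_floor_add_one _
    rw [le_div_iff₀ hs] at hle
    rw [div_lt_iff₀ hs] at hlt
    have k1 : n * α ≤ √α := by
      have := mul_le_mul_of_nonneg_right hle hs.le
      rw [mul_assoc, hss] at this; linarith
    -- Here `1 < (n + 1) * √α ≤ 2 * n * √α`, since `n ≥ 1`.
    have k2 : 1 / (n : ℝ) ≤ 2 * √α := by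
      rw [div_le_iff₀ (by linarith)]; nlinarith
    have k3 : α ≤ 1 / n := by
      rw [le_div_iff₀ (by linarith)]; linarith
    refine (H.abs_rectIntegral_sub_le_grid hn k3 hS hT).trans ?_
    have m1 := mul_le_mul_of_nonneg_left k1 hM
    have m2 := mul_le_mul_of_nonneg_left k2 hM
    have m3 : 18 * M / n = 18 * (M * (1 / n)) := by ring
    rw [m3]; linarith

end IsCellApprox

/-! ### Suprema of cell averages. -/

theorem cellAverage_abs_le {f : SquareFun} {M : ℝ} (hM : 0 ≤ M)
    (hf : ∀ᵐ p, |Function.uncurry f p| ≤ M) (S T : Set unitInterval) :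
    |cellAverage f S T| ≤ M := by
  unfold cellAverage
  rw [abs_div, abs_of_nonneg (measureReal_nonneg (μ := volume) (s := S ×ˢ T))]
  refine div_le_of_le_mul₀ measureReal_nonneg hM ?_
  rw [volume_real_prod]
  exact abs_rectIntegral_le hf S T

theorem cellAverage_of_volume_eq {f : SquareFun} {S T : Set unitInterval} {α : ℝ}
    (hS : volume.real S = α) (hT : volume.real T = α) :
    cellAverage f S T = rectIntegral f S T / (α * α) := by
  rw [cellAverage, volume_real_prod, hS, hT]

/-- The averages of `f` over the cells `S × T` in the upper left region of `(x, y)` with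
`|S| = |T| ∈ 𝒮`. -/
def cellAverages (f : SquareFun) (𝒮 : Set ℝ) (x y : unitInterval) : Set ℝ :=
  {r | ∃ S T : Set unitInterval, MeasurableSet S ∧ MeasurableSet T ∧ S ×ˢ T ⊆ upperLeft x y ∧
    volume.real S ∈ 𝒮 ∧ volume.real T = volume.real S ∧ r = cellAverage f S T}

/-- The supremum of the cell averages at `(x, y)`, with `-M` as a lower bound. -/
noncomputable def cellSup (f : SquareFun) (M : ℝ) (𝒮 : Set ℝ) : SquareFun := fun x y =>
  sSup (insert (-M) (cellAverages f 𝒮 x y))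

section CellSup

variable {f : SquareFun} {M : ℝ}

theorem abs_le_of_mem_cellAverages (hM : 0 ≤ M) (hf : ∀ᵐ p, |Function.uncurry f p| ≤ M)
    {𝒮 : Set ℝ} {x y : unitInterval} {r : ℝ} (hr : r ∈ cellAverages f 𝒮 x y) : |r| ≤ M := by
  obtain ⟨S, T, -, -, -, -, -, rfl⟩ := hr
  exact cellAverage_abs_le hM hf S T

theorem upperBound_insert_cellAverages (hM : 0 ≤ M) (hf : ∀ᵐ p, |Function.uncurry f p| ≤ M)
    (𝒮 : Set ℝ) (x y : unitInterval) :
    M ∈ upperBounds (insert (-M) (cellAverages f 𝒮 x y)) := by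
  rintro r (rfl | hr)
  · linarith
  · exact (abs_le.1 (abs_le_of_mem_cellAverages hM hf hr)).2

theorem abs_cellSup_le (hM : 0 ≤ M) (hf : ∀ᵐ p, |Function.uncurry f p| ≤ M) (𝒮 : Set ℝ)
    (x y : unitInterval) : |cellSup f M 𝒮 x y| ≤ M := by
  have hb := upperBound_insert_cellAverages hM hf 𝒮 x y
  exact abs_le.2 ⟨le_csSup ⟨M, hb⟩ (Set.mem_insert _ _), csSup_le (Set.insert_nonempty _ _) hb⟩

theorem cellAverages_mono (f : SquareFun) (𝒮 : Set ℝ) {x x' y y' : unitInterval} (hx : x ≤ x')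
    (hy : y' ≤ y) : cellAverages f 𝒮 x y ⊆ cellAverages f 𝒮 x' y' := by
  rintro r ⟨S, T, hS, hT, hsub, h⟩
  exact ⟨S, T, hS, hT, hsub.trans
    (Set.prod_mono (Set.Iic_subset_Iic.2 hx) (Set.Ici_subset_Ici.2 hy)), h⟩

theorem cellSup_mono (hM : 0 ≤ M) (hf : ∀ᵐ p, |Function.uncurry f p| ≤ M) (𝒮 : Set ℝ)
    {x x' y y' : unitInterval} (hx : x ≤ x') (hy : y' ≤ y) :
    cellSup f M 𝒮 x y ≤ cellSup f M 𝒮 x' y' :=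
  csSup_le_csSup ⟨M, upperBound_insert_cellAverages hM hf 𝒮 x' y'⟩ (Set.insert_nonempty _ _)
    (Set.insert_subset_insert (cellAverages_mono f 𝒮 hx hy))

theorem rectIntegral_le_cellSup (hM : 0 ≤ M) (hf : ∀ᵐ p, |Function.uncurry f p| ≤ M)
    {𝒮 : Set ℝ} {α : ℝ} (hα : 0 < α) (hα𝒮 : α ∈ 𝒮) {x y : unitInterval} {P Q : Set unitInterval}
    (hP : MeasurableSet P) (hQ : MeasurableSet Q) (hPα : volume.real P = α)
    (hQα : volume.real Q = α) (hPx : P ⊆ Set.Iic x) (hQy : Q ⊆ Set.Ici y) :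
    rectIntegral f P Q ≤ cellSup f M 𝒮 x y * (α * α) := by
  rw [← div_le_iff₀ (by positivity), ← cellAverage_of_volume_eq hPα hQα]
  refine le_csSup ⟨M, upperBound_insert_cellAverages hM hf 𝒮 x y⟩ (Or.inr ?_)
  exact ⟨P, Q, hP, hQ, Set.prod_mono hPx hQy, hPα ▸ hα𝒮, hQα.trans hPα.symm, rfl⟩

end CellSup

/-! ### Measurability and integrability. -/

/-- Measurability of functions that are monotone in one and antitone in the other variable. -/
theorem aemeasurable_of_mono {g : SquareFun}
    (hg : ∀ ⦃x x' y y'⦄, x ≤ x' → y' ≤ y → g x y ≤ g x' y') :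
    AEMeasurable (Function.uncurry g) volume := by
  apply NullMeasurable.aemeasurable
  refine measurable_of_Ioi (δ := NullMeasurableSpace (unitInterval × unitInterval) volume)
    fun c => ?_
  change NullMeasurableSet (Function.uncurry g ⁻¹' Set.Ioi c) volume
  -- The superlevel set agrees with the region below the graph of the monotone function `h`, except
  -- possibly on the graph, which is null by Fubini.
  let h : unitInterval → unitInterval := fun x => sSup {y | c < g x y}
  have hmono : Monotone h := fun x x' hx =>
    sSup_le_sSup fun y (hy : c < g x y) => hy.trans_le (hg hx le_rfl)
  have hU : MeasurableSet {p : unitInterval × unitInterval | p.2 < h p.1} :=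
    measurableSet_lt measurable_snd (hmono.measurable.comp measurable_fst)
  have hG : MeasurableSet {p : unitInterval × unitInterval | p.2 = h p.1} :=
    measurableSet_eq_fun measurable_snd (hmono.measurable.comp measurable_fst)
  have h0 : volume {p : unitInterval × unitInterval | p.2 = h p.1} = 0 := by
    rw [Measure.volume_eq_prod, Measure.measure_prod_null hG]
    refine Filter.Eventually.of_forall fun x => ?_
    have : Prod.mk x ⁻¹' {p : unitInterval × unitInterval | p.2 = h p.1} = {h x} := by
      ext y; simp
    change volume (Prod.mk x ⁻¹' {p : unitInterval × unitInterval | p.2 = h p.1}) = 0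
    rw [this]
    exact measure_singleton _
  refine hU.nullMeasurableSet.congr ?_
  have hae : ∀ᵐ p : unitInterval × unitInterval, p.2 ≠ h p.1 := by
    rw [ae_iff]; simpa using h0
  filter_upwards [hae] with p hp
  apply propext
  change p.2 < h p.1 ↔ c < g p.1 p.2
  constructor
  · intro hlt
    obtain ⟨y, hy, hpy⟩ := lt_sSup_iff.1 hlt
    exact lt_of_lt_of_le hy (hg le_rfl hpy.le)
  · intro hc
    exact lt_of_le_of_ne (le_sSup hc) hp

theorem aemeasurable_min_max {g : SquareFun} (hg : AEMeasurable (Function.uncurry g) volume) :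
    AEMeasurable (fun p : unitInterval × unitInterval => g (min p.1 p.2) (max p.1 p.2))
      volume := by
  classical
  have hsw : MeasurePreserving (Prod.swap : unitInterval × unitInterval → _) volume volume :=
    Measure.measurePreserving_swap
  have hle : MeasurableSet {p : unitInterval × unitInterval | p.1 ≤ p.2} :=
    measurableSet_le measurable_fst measurable_snd
  refine ⟨fun p => if p.1 ≤ p.2 then hg.mk _ p else hg.mk _ p.swap,
    Measurable.ite hle hg.measurable_mk (hg.measurable_mk.comp measurable_swap), ?_⟩
  have h2 := hsw.quasiMeasurePreserving.ae_eq_comp hg.ae_eq_mk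
  filter_upwards [hg.ae_eq_mk, h2] with p h1 h2
  by_cases hp : p.1 ≤ p.2
  · simp only [hp, if_true, min_eq_left, max_eq_right, ← h1]; rfl
  · have hp' := (not_le.1 hp).le
    simp only [hp, if_false, min_eq_right hp', max_eq_left hp']
    exact h2

theorem integrable_of_abs_le {f : SquareFun} {M : ℝ}
    (hm : AEMeasurable (Function.uncurry f) volume) (hf : ∀ᵐ p, |Function.uncurry f p| ≤ M) :
    Integrable (Function.uncurry f) volume :=
  Integrable.of_bound hm.aestronglyMeasurable M hf

/-! ### Comparing cells by means of the Robinson parameter. -/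

theorem volume_eq_of_real {S T : Set unitInterval} (h : volume.real S = volume.real T) :
    volume S = volume T :=
  (ENNReal.toReal_eq_toReal_iff' (measure_ne_top _ _) (measure_ne_top _ _)).1 h

theorem nonempty_of_volume_pos {S : Set unitInterval} (h : 0 < volume.real S) : S.Nonempty := by
  rw [Set.nonempty_iff_ne_empty]
  rintro rfl
  simp at h

section Param

variable {f : SquareFun} {M : ℝ}

theorem abs_rectIntegral_le_of_nonneg (hM : 0 ≤ M) (hf : ∀ᵐ p, |Function.uncurry f p| ≤ M)
    (S T : Set unitInterval) : |rectIntegral f S T| ≤ M := by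
  refine (abs_rectIntegral_le hf S T).trans (mul_le_of_le_one_right hM ?_)
  exact mul_le_one₀ measureReal_le_one measureReal_nonneg measureReal_le_one

theorem bddAbove_fst (hM : 0 ≤ M) (hf : ∀ᵐ p, |Function.uncurry f p| ≤ M) :
    BddAbove {r : ℝ | ∃ A B C : Set unitInterval, IsOrderedTriple A B C ∧
      r = rectIntegral f A C - rectIntegral f B C} := by
  refine ⟨2 * M, ?_⟩
  rintro r ⟨A, B, C, -, rfl⟩
  have h1 := (abs_le.1 (abs_rectIntegral_le_of_nonneg hM hf A C)).2
  have h2 := (abs_le.1 (abs_rectIntegral_le_of_nonneg hM hf B C)).1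
  linarith

theorem bddAbove_snd (hM : 0 ≤ M) (hf : ∀ᵐ p, |Function.uncurry f p| ≤ M) :
    BddAbove {r : ℝ | ∃ X Y Z : Set unitInterval, IsOrderedTriple X Y Z ∧
      r = rectIntegral f X Z - rectIntegral f X Y} := by
  refine ⟨2 * M, ?_⟩
  rintro r ⟨A, B, C, -, rfl⟩
  have h1 := (abs_le.1 (abs_rectIntegral_le_of_nonneg hM hf A C)).2
  have h2 := (abs_le.1 (abs_rectIntegral_le_of_nonneg hM hf A B)).1
  linarith

theorem isOrderedTriple_empty : IsOrderedTriple ∅ ∅ ∅ := by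
  constructor <;> simp [SetLE]

theorem robinsonParam_nonneg (hM : 0 ≤ M) (hf : ∀ᵐ p, |Function.uncurry f p| ≤ M) :
    0 ≤ robinsonParam f := by
  unfold robinsonParam
  have h1 := le_csSup (bddAbove_fst hM hf) (a := 0) ⟨∅, ∅, ∅, isOrderedTriple_empty, by simp⟩
  have h2 := le_csSup (bddAbove_snd hM hf) (a := 0) ⟨∅, ∅, ∅, isOrderedTriple_empty, by simp⟩
  linarith

/-- The triple `S ≤ P ≤ T` moves the first side, then `P ≤ Q ≤ T` moves the second. The factor `2`
cancels the halves in the definition of `robinsonParam`. -/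
theorem rectIntegral_le_add_robinsonParam (hM : 0 ≤ M) (hf : ∀ᵐ p, |Function.uncurry f p| ≤ M)
    {S P Q T : Set unitInterval} {x y : unitInterval} {α : ℝ} (hα : 0 < α) (hS : MeasurableSet S)
    (hP : MeasurableSet P) (hQ : MeasurableSet Q) (hT : MeasurableSet T)
    (hSα : volume.real S = α) (hPα : volume.real P = α) (hQα : volume.real Q = α)
    (hTα : volume.real T = α) (hSx : S ⊆ Set.Iic x) (hPx : P ⊆ Set.Ici x) (hPQ : SetLE P Q)
    (hQy : Q ⊆ Set.Iic y) (hTy : T ⊆ Set.Ici y) :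
    rectIntegral f S T ≤ rectIntegral f P Q + 2 * robinsonParam f := by
  obtain ⟨q, hq⟩ := nonempty_of_volume_pos (hQα ▸ hα)
  have hPy : P ⊆ Set.Iic y := fun z hz => (hPQ z hz q hq).trans (hQy hq)
  have h1 := le_csSup (bddAbove_fst hM hf) (a := rectIntegral f S T - rectIntegral f P T)
    ⟨S, P, T, ⟨hS, hP, hT, fun a ha b hb => (hSx ha).trans (hPx hb),
      fun a ha b hb => (hPy ha).trans (hTy hb), volume_eq_of_real (hSα.trans hPα.symm),
      volume_eq_of_real (hPα.trans hTα.symm)⟩, rfl⟩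
  have h2 := le_csSup (bddAbove_snd hM hf) (a := rectIntegral f P T - rectIntegral f P Q)
    ⟨P, Q, T, ⟨hP, hQ, hT, hPQ,
      fun a ha b hb => (hQy ha).trans (hTy hb), volume_eq_of_real (hPα.trans hQα.symm),
      volume_eq_of_real (hQα.trans hTα.symm)⟩, rfl⟩
  unfold robinsonParam
  linarith

/-- Splitting both sides of a cell of side `N * β` into cells of side `β`. -/
theorem exists_subcells (hf : ∀ᵐ p, |Function.uncurry f p| ≤ M)
    (hi : Integrable (Function.uncurry f) volume) {β : ℝ} (hβ : 0 ≤ β) (N : ℕ)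
    {S T : Set unitInterval} (hS : MeasurableSet S) (hT : MeasurableSet T)
    (hSβ : volume.real S = N * β) (hTβ : volume.real T = N * β) :
    ∃ E F : Fin N → Set unitInterval, (∀ i, MeasurableSet (E i)) ∧ (∀ i, MeasurableSet (F i)) ∧
      (∀ i, E i ⊆ S) ∧ (∀ i, F i ⊆ T) ∧ (∀ i, volume.real (E i) = β) ∧
      (∀ i, volume.real (F i) = β) ∧
      rectIntegral f S T = ∑ i, ∑ j, rectIntegral f (E i) (F j) := by
  obtain ⟨E, hE, hES, hEβ, hEd⟩ := exists_pieces β hβ N S hS hSβ.ge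
  obtain ⟨F, hF, hFT, hFβ, hFd⟩ := exists_pieces β hβ N T hT hTβ.ge
  refine ⟨E, F, hE, hF, hES, hFT, hEβ, hFβ, ?_⟩
  rw [← rectIntegral_iUnion hi hE hF hEd hFd]
  have hUm : MeasurableSet (⋃ i, E i) := MeasurableSet.iUnion hE
  have hVm : MeasurableSet (⋃ i, F i) := MeasurableSet.iUnion hF
  have hU0 : volume.real (S \ ⋃ i, E i) = 0 := by
    rw [measureReal_sdiff (Set.iUnion_subset hES) hUm, measureReal_iUnion_fintype hEd hE, hSβ]
    simp [hEβ]
  have hV0 : volume.real (T \ ⋃ i, F i) = 0 := by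
    rw [measureReal_sdiff (Set.iUnion_subset hFT) hVm, measureReal_iUnion_fintype hFd hF, hTβ]
    simp [hFβ]
  have e1 := rectIntegral_left_diff hi hUm hT (Set.iUnion_subset hES)
  have e2 := rectIntegral_right_diff hi hVm hUm (Set.iUnion_subset hFT)
  have b1 := abs_rectIntegral_le hf (S \ ⋃ i, E i) T
  have b2 := abs_rectIntegral_le hf (⋃ i, E i) (T \ ⋃ i, F i)
  rw [hU0, zero_mul, mul_zero] at b1
  rw [hV0, mul_zero, mul_zero] at b2
  have := abs_nonpos_iff.1 b1
  have := abs_nonpos_iff.1 b2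
  linarith

theorem subset_of_prod_subset_upperLeft {S T : Set unitInterval} {x y : unitInterval}
    (hS : S.Nonempty) (hT : T.Nonempty) (h : S ×ˢ T ⊆ upperLeft x y) :
    S ⊆ Set.Iic x ∧ T ⊆ Set.Ici y := by
  obtain ⟨s, hs⟩ := hS
  obtain ⟨t, ht⟩ := hT
  exact ⟨fun a ha => (h (Set.mk_mem_prod ha ht)).1, fun b hb => (h (Set.mk_mem_prod hs hb)).2⟩

theorem cellSup_le_add (hM : 0 ≤ M) (hf : ∀ᵐ p, |Function.uncurry f p| ≤ M)
    {α : ℝ} (hα : 0 < α) {x y : unitInterval} {P Q : Set unitInterval}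
    (hP : MeasurableSet P) (hQ : MeasurableSet Q) (hPα : volume.real P = α)
    (hQα : volume.real Q = α) (hPx : P ⊆ Set.Ici x) (hQy : Q ⊆ Set.Iic y) (hPQ : SetLE P Q) :
    cellSup f M {α} x y * (α * α) ≤
      rectIntegral f P Q + 2 * robinsonParam f / (α * α) * (α * α) := by
  have hαα : 0 < α * α := by positivity
  have hΛ := robinsonParam_nonneg hM hf
  rw [div_mul_cancel₀ _ hαα.ne', ← le_div_iff₀ hαα]
  refine csSup_le (Set.insert_nonempty _ _) ?_
  rintro r (rfl | ⟨S, T, hS, hT, hsub, hSα, hTα, rfl⟩)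
  -- The inserted value `-M` lies below every cell average.
  · have := (abs_le.1 (abs_rectIntegral_le hf P Q)).1
    rw [hPα, hQα] at this
    rw [le_div_iff₀ hαα]; linarith
  · rw [Set.mem_singleton_iff] at hSα
    rw [hSα] at hTα
    rw [cellAverage_of_volume_eq hSα hTα]
    obtain ⟨hSx, hTy⟩ := subset_of_prod_subset_upperLeft
      (nonempty_of_volume_pos (hSα ▸ hα)) (nonempty_of_volume_pos (hTα ▸ hα)) hsub
    refine div_le_div_of_nonneg_right ?_ hαα.le
    exact rectIntegral_le_add_robinsonParam hM hf hα hS hP hQ hT hSα hPα hQα hTα hSx hPx hPQ hQy hTy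

/-- Cells of different dyadic sizes compare if `f` has Robinson parameter zero. -/
theorem cellAverage_le_of_dyadic (hM : 0 ≤ M) (hf : ∀ᵐ p, |Function.uncurry f p| ≤ M)
    (hi : Integrable (Function.uncurry f) volume) (hΛ : robinsonParam f = 0) {k m : ℕ}
    {x y : unitInterval} {S P Q T : Set unitInterval} (hS : MeasurableSet S)
    (hP : MeasurableSet P) (hQ : MeasurableSet Q) (hT : MeasurableSet T)
    (hSk : volume.real S = (1 / 2 : ℝ) ^ k) (hTk : volume.real T = (1 / 2 : ℝ) ^ k)
    (hPm : volume.real P = (1 / 2 : ℝ) ^ m) (hQm : volume.real Q = (1 / 2 : ℝ) ^ m)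
    (hSx : S ⊆ Set.Iic x) (hPx : P ⊆ Set.Ici x) (hPQ : SetLE P Q)
    (hQy : Q ⊆ Set.Iic y) (hTy : T ⊆ Set.Ici y) :
    cellAverage f S T ≤ cellAverage f P Q := by
  rw [cellAverage_of_volume_eq hSk hTk, cellAverage_of_volume_eq hPm hQm]
  have hpos (l : ℕ) : (0 : ℝ) < (1 / 2) ^ l := by positivity
  have hsplit {a b : ℕ} (hab : a ≤ b) :
      (1 / 2 : ℝ) ^ a = ((2 ^ (b - a) : ℕ) : ℝ) * (1 / 2) ^ b := by
    obtain ⟨c, rfl⟩ := Nat.exists_eq_add_of_le hab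
    rw [pow_add, Nat.add_sub_cancel_left]
    push_cast
    rw [mul_left_comm, ← mul_pow]
    norm_num
  -- The ratio of the side lengths is a power of two. The larger cell is split into `N * N` cells of
  -- the smaller size, each of which compares with the smaller cell.
  rcases le_total k m with hkm | hkm
  · set N := 2 ^ (m - k) with hN
    have e := hsplit hkm
    rw [← hN] at e
    obtain ⟨E, F, hE, hF, hES, hFT, hEm, hFm, hsum⟩ :=
      exists_subcells hf hi (hpos m).le N hS hT (hSk.trans e) (hTk.trans e)
    have hle : rectIntegral f S T ≤ N * (N * rectIntegral f P Q) := by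
      rw [hsum]
      calc _ ≤ ∑ i : Fin N, ∑ j : Fin N, rectIntegral f P Q :=
            Finset.sum_le_sum fun i _ => Finset.sum_le_sum fun j _ => by
              have := rectIntegral_le_add_robinsonParam hM hf (hpos m) (hE i) hP hQ (hF j)
                (hEm i) hPm hQm (hFm j) ((hES i).trans hSx) hPx hPQ hQy ((hFT j).trans hTy)
              rwa [hΛ, mul_zero, add_zero] at this
        _ = _ := by simp
    rw [e]
    rw [div_le_div_iff₀ (by have := hpos m; positivity) (by have := hpos m; positivity)]
    have := mul_le_mul_of_nonneg_right hle
      (by have := hpos m; positivity : (0 : ℝ) ≤ (1 / 2) ^ m * (1 / 2) ^ m)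
    linarith
  · set N := 2 ^ (k - m) with hN
    have e := hsplit hkm
    rw [← hN] at e
    obtain ⟨E, F, hE, hF, hEP, hFQ, hEk, hFk, hsum⟩ :=
      exists_subcells hf hi (hpos k).le N hP hQ (hPm.trans e) (hQm.trans e)
    have hle : N * (N * rectIntegral f S T) ≤ rectIntegral f P Q := by
      rw [hsum]
      calc _ = ∑ i : Fin N, ∑ j : Fin N, rectIntegral f S T := by simp
        _ ≤ _ := Finset.sum_le_sum fun i _ => Finset.sum_le_sum fun j _ => by
              have := rectIntegral_le_add_robinsonParam hM hf (hpos k) hS (hE i) (hF j) hT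
                hSk (hEk i) (hFk j) hTk hSx ((hEP i).trans hPx)
                (fun a ha b hb => hPQ a (hEP i ha) b (hFQ j hb)) ((hFQ j).trans hQy) hTy
              rwa [hΛ, mul_zero, add_zero] at this
    rw [e]
    rw [div_le_div_iff₀ (by have := hpos k; positivity) (by have := hpos k; positivity)]
    have := mul_le_mul_of_nonneg_right hle
      (by have := hpos k; positivity : (0 : ℝ) ≤ (1 / 2) ^ k * (1 / 2) ^ k)
    linarith

end Param

/-- Measurable rectangles form a π-system generating the product σ-algebra, so the vanishing of
integrals extends to all measurable sets. -/
theorem ae_eq_zero_of_rectIntegral_eq_zero {h : SquareFun}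
    (hi : Integrable (Function.uncurry h) volume)
    (h0 : ∀ S T : Set unitInterval, MeasurableSet S → MeasurableSet T → rectIntegral h S T = 0) :
    Function.uncurry h =ᵐ[volume] 0 := by
  refine hi.ae_eq_zero_of_forall_setIntegral_eq_zero fun s hs _ => ?_
  have huniv : ∫ p, Function.uncurry h p = 0 := by
    have := h0 Set.univ Set.univ MeasurableSet.univ MeasurableSet.univ
    rwa [rectIntegral, Set.univ_prod_univ, Measure.restrict_univ] at this
  induction s, hs using MeasurableSpace.induction_on_inter generateFrom_prod.symm isPiSystem_prod with
  | empty => simp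
  | basic s hs =>
    obtain ⟨S, hS, T, hT, rfl⟩ := hs
    exact h0 S T hS hT
  | compl s hs ih =>
    have := integral_add_compl hs hi
    have ih := ih (measure_lt_top _ _)
    linarith
  | iUnion s hd hs ih =>
    rw [integral_iUnion hs hd hi.integrableOn]
    simp [ih]

/-! ### The case of Robinson parameter zero. -/

section Approx

variable {f : SquareFun} {M : ℝ}

/-- A symmetric bounded function with Robinson parameter zero is Robinson almost everywhere. -/
theorem isRobinsonAE_of_robinsonParam_eq_zero (hM : 0 ≤ M)
    (hf : ∀ᵐ p, |Function.uncurry f p| ≤ M) (hfm : AEMeasurable (Function.uncurry f) volume)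
    (hs : ∀ x y, f x y = f y x) (hΛ : robinsonParam f = 0) : IsRobinsonAE f := by
  -- Allowing all dyadic sizes makes `g` independent of the scale. The same `v` and `g` then serve
  -- for cells of every size `(1 / 2) ^ m`, with error `0`.
  let 𝒮 : Set ℝ := Set.range fun k : ℕ => (1 / 2 : ℝ) ^ k
  let g : SquareFun := cellSup f M 𝒮
  let v : SquareFun := fun x y => g (min x y) (max x y)
  have hi := integrable_of_abs_le hfm hf
  have hg : ∀ ⦃x x' y y'⦄, x ≤ x' → y' ≤ y → g x y ≤ g x' y' :=
    fun _ _ _ _ hx hy => cellSup_mono hM hf 𝒮 hx hy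
  have hgM : ∀ x y, |g x y| ≤ M := abs_cellSup_le hM hf 𝒮
  have hvi : Integrable (Function.uncurry v) volume :=
    integrable_of_abs_le (aemeasurable_min_max (aemeasurable_of_mono hg))
      (Filter.Eventually.of_forall fun p => hgM _ _)
  have hvs : ∀ x y, v x y = v y x := fun x y => by simp only [v, min_comm x y, max_comm x y]
  have H (m : ℕ) : IsCellApprox f v g M ((1 / 2) ^ m) 0 :=
    { integrable_left := hi
      symm_left := hs
      bound_left := hf
      integrable_right := hvi
      symm_right := hvs
      bound_right := fun x y => hgM _ _
      bound := hgM
      mono := hg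
      eq_of_le := fun x y hxy _ _ => by simp only [v, min_eq_left hxy, max_eq_right hxy]
      pos := by positivity
      nonneg := le_rfl
      le_of_subset := fun x y P Q hP hQ hPα hQα hPx hQy =>
        rectIntegral_le_cellSup hM hf (by positivity) (Set.mem_range_self m) hP hQ hPα hQα hPx hQy
      le_add_of_subset := by
        intro x y P Q hP hQ hPα hQα hPx hQy hPQ
        rw [zero_mul, add_zero, ← le_div_iff₀ (by positivity), ← cellAverage_of_volume_eq hPα hQα]
        refine csSup_le (Set.insert_nonempty _ _) ?_
        rintro r (rfl | ⟨S, T, hS, hT, hsub, ⟨k, hk⟩, hTS, rfl⟩)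
        · exact (abs_le.1 (cellAverage_abs_le hM hf P Q)).1
        · have hk' : volume.real S = (1 / 2) ^ k := hk.symm
          rw [hk'] at hTS
          have hpos : (0 : ℝ) < (1 / 2) ^ k := by positivity
          obtain ⟨hSx, hTy⟩ := subset_of_prod_subset_upperLeft
            (nonempty_of_volume_pos (hk' ▸ hpos)) (nonempty_of_volume_pos (hTS ▸ hpos)) hsub
          exact cellAverage_le_of_dyadic hM hf hi hΛ hS hP hQ hT hk' hTS hPα hQα hSx hPx hPQ hQy
            hTy }
  refine ⟨v, hvi, hvs, ?_, ?_⟩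
  · intro x y z hxy hyz
    have hxz := hxy.trans hyz
    simp only [v, min_eq_left hxy, min_eq_left hyz, max_eq_right hxy, max_eq_right hyz,
      min_eq_left hxz, max_eq_right hxz]
    exact le_min (hg le_rfl hyz) (hg hxy le_rfl)
  -- The cut norm bound `40 * (M * √((1 / 2) ^ m))` holds for every `m` and tends to zero.
  · have hzero := ae_eq_zero_of_rectIntegral_eq_zero (H 0).integrable_sub fun S T hS hT => by
      have hlim : Filter.Tendsto (fun m : ℕ => 40 * (M * √((1 / 2 : ℝ) ^ m)) + 0)
          Filter.atTop (nhds (40 * (M * √0) + 0)) :=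
        (((Real.continuous_sqrt.tendsto 0).comp (tendsto_pow_atTop_nhds_zero_of_lt_one
          (by norm_num) (by norm_num))).const_mul M |>.const_mul 40).add_const 0
      have := ge_of_tendsto' hlim fun m => (H m).abs_rectIntegral_sub_le hS hT
      rw [Real.sqrt_zero, mul_zero, mul_zero, add_zero] at this
      exact abs_nonpos_iff.1 this
    filter_upwards [hzero] with p hp
    exact (sub_eq_zero.1 hp).symm

/-! ### The Robinson approximation for positive parameter. -/

/-- A cell fits into the upper left region exactly when both sides of that region have length at
least `α`; otherwise the supremum is over the empty set. -/
theorem robinsonApprox_eq_of_pos (hM : 0 ≤ M) (hf : ∀ᵐ p, |Function.uncurry f p| ≤ M) {α : ℝ}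
    (hα : 0 < α) (x y : unitInterval) :
    robinsonApprox f α x y = if α ≤ (min x y : unitInterval) ∧ ((max x y : unitInterval) : ℝ) ≤ 1 - α
      then cellSup f M {α} (min x y) (max x y) else 0 := by
  have hset : {r : ℝ | ∃ S T : Set unitInterval, MeasurableSet S ∧ MeasurableSet T ∧
      S ×ˢ T ⊆ upperLeft (min x y) (max x y) ∧ volume.real S = α ∧ volume.real T = α ∧
      r = cellAverage f S T} = cellAverages f {α} (min x y) (max x y) := by
    ext r
    refine exists_congr fun S => exists_congr fun T => ?_
    rw [Set.mem_singleton_iff]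
    constructor
    · rintro ⟨h1, h2, h3, h4, h5, h6⟩; exact ⟨h1, h2, h3, h4, h5.trans h4.symm, h6⟩
    · rintro ⟨h1, h2, h3, h4, h5, h6⟩; exact ⟨h1, h2, h3, h4, h5.trans h4, h6⟩
  rw [robinsonApprox, if_neg (fun h => hα.ne' h.1), hset]
  generalize min x y = a
  generalize max x y = b
  have hIic : volume.real (Set.Iic a) = a := by
    rw [measureReal_def, unitInterval.volume_Iic, ENNReal.toReal_ofReal a.2.1]
  have hIci : volume.real (Set.Ici b) = 1 - b := by
    rw [measureReal_def, unitInterval.volume_Ici,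
      ENNReal.toReal_ofReal (by linarith [b.2.2] : (0 : ℝ) ≤ 1 - b)]
  split_ifs with h
  · obtain ⟨s, hs⟩ := exists_volume_inter_Iic_eq (S := Set.Iic a) hα.le (hIic ▸ h.1)
    obtain ⟨t, ht⟩ := exists_volume_inter_Iic_eq (S := Set.Ici b) hα.le
      (by rw [hIci]; linarith [h.2])
    have hmem : cellAverage f (Set.Iic a ∩ Set.Iic s) (Set.Ici b ∩ Set.Iic t) ∈
        cellAverages f {α} a b :=
      ⟨_, _, measurableSet_Iic.inter measurableSet_Iic, measurableSet_Ici.inter measurableSet_Iic,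
        Set.prod_mono Set.inter_subset_left Set.inter_subset_left, hs, ht.trans hs.symm, rfl⟩
    have hb : BddAbove (cellAverages f {α} a b) :=
      ⟨M, fun r hr => (abs_le.1 (abs_le_of_mem_cellAverages hM hf hr)).2⟩
    -- Once some cell fits, the inserted `-M` does not affect the supremum.
    rw [cellSup, csSup_insert hb ⟨_, hmem⟩]
    exact (sup_eq_right.2 (le_trans (abs_le.1 (abs_le_of_mem_cellAverages hM hf hmem)).1
      (le_csSup hb hmem))).symm
  · have : cellAverages f {α} a b = ∅ := by
      rw [Set.eq_empty_iff_forall_notMem]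
      rintro r ⟨S, T, -, -, hsub, hSα, hTS, -⟩
      rw [Set.mem_singleton_iff] at hSα
      rw [hSα] at hTS
      obtain ⟨hSa, hTb⟩ := subset_of_prod_subset_upperLeft
        (nonempty_of_volume_pos (hSα ▸ hα)) (nonempty_of_volume_pos (hTS ▸ hα)) hsub
      have h1 := measureReal_mono (μ := volume) hSa
      have h2 := measureReal_mono (μ := volume) hTb
      rw [hSα, hIic] at h1
      rw [hTS, hIci] at h2
      exact h ⟨h1, by linarith⟩
    rw [this, Real.sSup_empty]

theorem isCellApprox_robinsonApprox (hM : 0 ≤ M)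
    (hf : ∀ᵐ p, |Function.uncurry f p| ≤ M) (hfm : AEMeasurable (Function.uncurry f) volume)
    (hs : ∀ x y, f x y = f y x) {α : ℝ} (hα : 0 < α) :
    IsCellApprox f (robinsonApprox f α) (cellSup f M {α}) M α
      (2 * robinsonParam f / (α * α)) := by
  classical
  have hg : ∀ ⦃x x' y y'⦄, x ≤ x' → y' ≤ y → cellSup f M {α} x y ≤ cellSup f M {α} x' y' :=
    fun _ _ _ _ hx hy => cellSup_mono hM hf {α} hx hy
  have hgM := abs_cellSup_le hM hf {α}
  have hRM : ∀ x y, |robinsonApprox f α x y| ≤ M := by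
    intro x y
    rw [robinsonApprox_eq_of_pos hM hf hα]
    split_ifs
    · exact hgM _ _
    · simpa using hM
  have hD : MeasurableSet {p : unitInterval × unitInterval |
      α ≤ (min p.1 p.2 : unitInterval) ∧ ((max p.1 p.2 : unitInterval) : ℝ) ≤ 1 - α} :=
    (measurableSet_le measurable_const
      (measurable_subtype_coe.comp (measurable_fst.min measurable_snd))).inter
    (measurableSet_le (measurable_subtype_coe.comp (measurable_fst.max measurable_snd))
      measurable_const)
  have hRm : AEMeasurable (Function.uncurry (robinsonApprox f α)) volume := by
    refine ((aemeasurable_min_max (aemeasurable_of_mono hg)).indicator hD).congr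
      (Filter.Eventually.of_forall fun p => ?_)
    simp only [Set.indicator_apply, Set.mem_ofPred_eq]
    exact (robinsonApprox_eq_of_pos hM hf hα p.1 p.2).symm
  exact
    { integrable_left := integrable_of_abs_le hfm hf
      symm_left := hs
      bound_left := hf
      integrable_right :=
        integrable_of_abs_le hRm (Filter.Eventually.of_forall fun p => hRM p.1 p.2)
      symm_right := fun x y => by
        rw [robinsonApprox_eq_of_pos hM hf hα, robinsonApprox_eq_of_pos hM hf hα,
          min_comm, max_comm]
      bound_right := hRM
      bound := hgM
      mono := hg
      eq_of_le := fun x y hxy h1 h2 => by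
        rw [robinsonApprox_eq_of_pos hM hf hα, min_eq_left hxy, max_eq_right hxy, if_pos ⟨h1, h2⟩]
      pos := hα
      nonneg := by have := robinsonParam_nonneg hM hf; positivity
      le_of_subset := fun x y P Q hP hQ hPα hQα hPx hQy =>
        rectIntegral_le_cellSup hM hf hα (Set.mem_singleton α) hP hQ hPα hQα hPx hQy
      le_add_of_subset := fun x y P Q hP hQ hPα hQα hPx hQy hPQ =>
        cellSup_le_add hM hf hα hP hQ hPα hQα hPx hQy hPQ }

/-! ### Norm bounds and the choice of the parameter. -/

theorem cutNorm_le {h : SquareFun} {C : ℝ}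
    (hC : ∀ S T : Set unitInterval, MeasurableSet S → MeasurableSet T → |rectIntegral h S T| ≤ C) :
    cutNorm h ≤ C := by
  refine csSup_le ⟨_, ∅, ∅, MeasurableSet.empty, MeasurableSet.empty, rfl⟩ ?_
  rintro r ⟨S, T, hS, hT, rfl⟩
  exact hC S T hS hT

theorem ae_abs_le_supNorm (hb : ∃ M : ℝ, ∀ x y, |f x y| ≤ M) :
    ∀ᵐ p, |Function.uncurry f p| ≤ supNorm f := by
  obtain ⟨M, hM⟩ := hb
  have hfin : eLpNorm (Function.uncurry f) ⊤ volume ≠ ⊤ := by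
    rw [eLpNorm_exponent_top]
    exact (eLpNormEssSup_lt_top_of_ae_bound (C := M)
      (Filter.Eventually.of_forall fun p => hM p.1 p.2)).ne
  filter_upwards [ae_le_eLpNormEssSup (f := Function.uncurry f) (μ := volume)] with p hp
  rw [← eLpNorm_exponent_top] at hp
  have := ENNReal.toReal_mono hfin hp
  simpa [supNorm] using this

theorem robinsonApprox_of_isRobinsonAE (h : IsRobinsonAE f) : robinsonApprox f 0 = f := by
  ext x y
  rw [robinsonApprox, if_pos ⟨rfl, h⟩]

/-- The approximation bound for an exponent `a` of the essential supremum norm. -/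
theorem robinsonApprox_bound (hfm : AEMeasurable (Function.uncurry f) volume)
    (hs : ∀ x y, f x y = f y x) (hb : ∃ M : ℝ, ∀ x y, |f x y| ≤ M) {a α : ℝ} (ha : a ≠ 0)
    (hα : α = supNorm f ^ a * robinsonParam f ^ (2 / 5 : ℝ)) {C : ℝ} (hC : 0 ≤ C)
    (hC1 : supNorm f * supNorm f ^ (a / 2) ≤ C) (hC2 : supNorm f ^ (-2 * a) ≤ C) :
    Integrable (Function.uncurry (robinsonApprox f α)) volume ∧
      cutNorm (f - robinsonApprox f α) ≤ 44 * C * robinsonParam f ^ (1 / 5 : ℝ) := by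
  have hf := ae_abs_le_supNorm hb
  have hM : 0 ≤ supNorm f := ENNReal.toReal_nonneg
  have hΛ := robinsonParam_nonneg hM hf
  have hi := integrable_of_abs_le hfm hf
  have hα0 : 0 ≤ α := hα ▸ mul_nonneg (Real.rpow_nonneg hM _) (Real.rpow_nonneg hΛ _)
  rcases hα0.eq_or_lt with h0 | hpos
  -- If `supNorm f = 0`, all rectangle integrals vanish, so `Λ = 0` in either case. `Real.rpow`
  -- sends base `0` with nonzero exponent to `0`, which matches the convention `α = 0` there.
  · have hΛ0 : robinsonParam f = 0 := by
      rcases mul_eq_zero.1 (hα.symm.trans h0.symm) with h | h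
      · have hM0 : supNorm f = 0 := ((Real.rpow_eq_zero hM ha).1 h)
        have hz (S T) : rectIntegral f S T = 0 := by
          have := abs_rectIntegral_le hf S T
          rw [hM0, zero_mul] at this
          exact abs_nonpos_iff.1 this
        unfold robinsonParam
        have e1 : {r : ℝ | ∃ A B C : Set unitInterval, IsOrderedTriple A B C ∧
            r = rectIntegral f A C - rectIntegral f B C} ⊆ {0} := by
          rintro r ⟨A, B, C, -, rfl⟩; simp [hz]
        have e2 : {r : ℝ | ∃ X Y Z : Set unitInterval, IsOrderedTriple X Y Z ∧
            r = rectIntegral f X Z - rectIntegral f X Y} ⊆ {0} := by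
          rintro r ⟨A, B, C, -, rfl⟩; simp [hz]
        rcases Set.subset_singleton_iff_eq.1 e1 with e1 | e1 <;>
          rcases Set.subset_singleton_iff_eq.1 e2 with e2 | e2 <;> simp [e1, e2]
      · exact (Real.rpow_eq_zero hΛ (by norm_num)).1 h
    rw [← h0, robinsonApprox_of_isRobinsonAE
      (isRobinsonAE_of_robinsonParam_eq_zero hM hf hfm hs hΛ0)]
    refine ⟨hi, cutNorm_le fun S T _ _ => ?_⟩
    rw [rectIntegral_sub hi hi, sub_self, abs_zero]
    have := Real.rpow_nonneg hΛ (1 / 5)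
    positivity
  · have H := isCellApprox_robinsonApprox hM hf hfm hs hpos
    refine ⟨H.integrable_right, cutNorm_le fun S T hS hT => ?_⟩
    refine (H.abs_rectIntegral_sub_le hS hT).trans ?_
    have hMpos : 0 < supNorm f := by
      refine hM.lt_of_ne fun h => ?_
      rw [← h, Real.zero_rpow ha, zero_mul] at hα
      exact hpos.ne' hα
    have hΛpos : 0 < robinsonParam f := by
      refine hΛ.lt_of_ne fun h => ?_
      rw [← h, Real.zero_rpow (by norm_num), mul_zero] at hα
      exact hpos.ne' hα
    have hΛ5 := Real.rpow_nonneg hΛ (1 / 5)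
    have k1 : √α = supNorm f ^ (a / 2) * robinsonParam f ^ (1 / 5 : ℝ) := by
      rw [hα, Real.sqrt_mul (Real.rpow_nonneg hM _), Real.sqrt_eq_rpow, Real.sqrt_eq_rpow,
        ← Real.rpow_mul hM, ← Real.rpow_mul hΛ]
      norm_num [div_eq_mul_inv]
    have k2 : robinsonParam f / (α * α) =
        supNorm f ^ (-2 * a) * robinsonParam f ^ (1 / 5 : ℝ) := by
      rw [div_eq_iff (by positivity), hα]
      have e1 : supNorm f ^ (-2 * a) * (supNorm f ^ a * supNorm f ^ a) = 1 := by
        rw [← Real.rpow_add hMpos, ← Real.rpow_add hMpos]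
        ring_nf; exact Real.rpow_zero _
      have e2 : robinsonParam f ^ (1 / 5 : ℝ) *
          (robinsonParam f ^ (2 / 5 : ℝ) * robinsonParam f ^ (2 / 5 : ℝ)) = robinsonParam f := by
        rw [← Real.rpow_add hΛpos, ← Real.rpow_add hΛpos]
        norm_num
      calc _ = (supNorm f ^ (-2 * a) * (supNorm f ^ a * supNorm f ^ a)) *
          (robinsonParam f ^ (1 / 5 : ℝ) *
          (robinsonParam f ^ (2 / 5 : ℝ) * robinsonParam f ^ (2 / 5 : ℝ))) := by
            rw [e1, e2, one_mul]
        _ = _ := by ring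
    -- The two terms contribute `40 * C` and `2 * C`, so `42` would already do.
    rw [mul_div_assoc, k1, k2]
    have m1 := mul_le_mul_of_nonneg_right hC1 hΛ5
    have m2 := mul_le_mul_of_nonneg_right hC2 hΛ5
    have m3 := mul_nonneg hC hΛ5
    linarith

end Approx

theorem corollary4p8 (w u : SquareFun) (hw : IsGraphon w) (hu : IsKernel u)
    (α αs : ℝ)
    (hα : α = supNorm w ^ (-(1 / 3) : ℝ) * robinsonParam w ^ (2 / 5 : ℝ))
    (hαs : αs = supNorm u ^ (-(2 / 5) : ℝ) * robinsonParam u ^ (2 / 5 : ℝ)) :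
    (Integrable (Function.uncurry (robinsonApprox w α)) volume ∧
      cutNorm (w - robinsonApprox w α) ≤ 44 * robinsonParam w ^ (1 / 5 : ℝ)) ∧
    (Integrable (Function.uncurry (robinsonApprox u αs)) volume ∧
      cutNorm (u - robinsonApprox u αs) ≤
        44 * supNorm u ^ (4 / 5 : ℝ) * robinsonParam u ^ (1 / 5 : ℝ)) := by
  have hw1 : ∀ x y, |w x y| ≤ 1 := fun x y =>
    abs_le.2 ⟨by linarith [(hw.mem_Icc x y).1], (hw.mem_Icc x y).2⟩
  have hM0 (f : SquareFun) : 0 ≤ supNorm f := ENNReal.toReal_nonneg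
  have hle : supNorm w ≤ 1 := by
    refine ENNReal.toReal_le_of_le_ofReal zero_le_one ?_
    rw [eLpNorm_exponent_top]
    exact eLpNormEssSup_le_of_ae_bound (Filter.Eventually.of_forall fun p => hw1 p.1 p.2)
  have hpow {f : SquareFun} (b : ℝ) (hb : 1 + b ≠ 0) :
      supNorm f * supNorm f ^ b = supNorm f ^ (1 + b) := by
    rw [Real.rpow_add' (hM0 f) hb, Real.rpow_one]
  constructor
  -- For `a = -1/3` the powers of the norm are `5/6` and `2/3`, both at most `1` because `supNorm w
  -- ≤ 1`.
  · have := robinsonApprox_bound (C := 1) hw.aemeasurable hw.symm ⟨1, hw1⟩ (by norm_num) hα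
      zero_le_one
      (by rw [hpow _ (by norm_num)]; exact Real.rpow_le_one (hM0 w) hle (by norm_num))
      (Real.rpow_le_one (hM0 w) hle (by norm_num))
    rwa [mul_one] at this
  -- The exponent `a = -2/5` solves `1 + a/2 = -2a`, so both powers of the norm are `4/5`.
  · refine robinsonApprox_bound hu.aemeasurable hu.symm hu.bounded (by norm_num) hαs
      (Real.rpow_nonneg (hM0 u) _) (le_of_eq ?_) (le_of_eq ?_)
    · rw [hpow _ (by norm_num)]; norm_num
    · norm_num
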